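/- **Setting.** For positive integers $n,d$ and $1\le\sigma\le d$, a matrix $M\in\mathbb R^{n\times d}$ and $b\in\mathbb R^n$, the sparse integer least squares problem (SILS) is $$\min\ \tfrac1n\|Mx-b\|_2^2\quad\text{s.t. } x\in\{0,\pm1\}^d,\ \|x\|_0=\sigma .$$ With $A:=(-b\ \ M)\in\mathbb R^{n\times(1+d)}$, its semidefinite relaxation (SILS-SDP) is $$\min\ \tfrac1n\operatorname{tr}(A^\top A W)\quad\text{s.t. } W\succeq0,\ W_{11}=1,\ \operatorname{tr}(W_x)=\sigma,\ \textstyle\sum_{i,j}|(W_x)_{ij}|\le\sigma^2,\ \operatorname{diag}(W_x)\le 1_d,$$ over symmetric $(1+d)\times(1+d)$ matrices $W$, where $W_x$ is $W$ without its first row and column. We say that SILS-SDP *recovers* $x^*\in\{0,\pm1\}^d$ if $\binom{1}{x^*}\binom{1}{x^*}^\top$ is the unique optimal solution of SILS-SDP, and that SILS-SDP *solves* SILS if it recovers some $x^*\in\{0,\pm1\}^d$ (such an $x^*$ is then optimal for SILS). A random variable $X$ is $\mathcal{SG}(v)$ if $\mathbb E\exp(t(X-\mathbb EX))\le\exp(vt^2/2)$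 for all $t\in\mathbb R$. **Model.** $b=Mz^*+\epsilon$, where the entries of $M$ are i.i.d., centered, $\mathcal{SG}(1)$ and of variance $1$; $z^*\in\mathbb R^d$ is deterministic with $z_i^*\in\{2,-2\}$ for $i\le\sigma$ and $z_i^*\in\{1,-1\}$ for $i>\sigma$ (arbitrary signs); and $\epsilon\in\mathbb R^n$ is independent of $M$, with i.i.d. centered $\mathcal{SG}(\varrho^2)$ entries, $\varrho\ge0$. **Theorem.** There exist absolute constants $C,K>0$ such that, for all $n,d,\sigma,\varrho$ and all data following this model with $$n\ \ge\ C\,(\sigma^2+d+\varrho^2)\,\log d,$$ SILS-SDP solves SILS with high probability, that is, with probability at least $1-\dfrac{K}{d}-K e^{-\sigma}$. -/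

import Mathlib

open MeasureTheory ProbabilityTheory
open scoped NNReal Matrix

/-- `x` is feasible for the sparse integer least squares problem (SILS):
`x ∈ {0, ±1}^d` and `‖x‖₀ = σ`. -/
structure SILSFeasible {d : ℕ} (σ : ℕ) (x : Fin d → ℝ) : Prop where
  entries : ∀ i, x i = 0 ∨ x i = 1 ∨ x i = -1
  card_support : (Finset.univ.filter fun i => x i ≠ 0).card = σ

/-- The objective `(1/n) ‖M x - b‖₂²` of (SILS). -/
noncomputable def silsCost {n d : ℕ} (M : Matrix (Fin n) (Fin d) ℝ) (b : Fin n → ℝ)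
    (x : Fin d → ℝ) : ℝ :=
  (1 / (n : ℝ)) * ∑ k, ((M *ᵥ x) k - b k) ^ 2

/-- `x` is an optimal solution of (SILS). -/
def SILSOptimal {n d : ℕ} (M : Matrix (Fin n) (Fin d) ℝ) (b : Fin n → ℝ) (σ : ℕ)
    (x : Fin d → ℝ) : Prop :=
  SILSFeasible σ x ∧ ∀ y, SILSFeasible σ y → silsCost M b x ≤ silsCost M b y

/-- The `n × (1+d)` matrix `A = (-b  M)`. -/
def sdpData {n d : ℕ} (M : Matrix (Fin n) (Fin d) ℝ) (b : Fin n → ℝ) :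
    Matrix (Fin n) (Fin (d + 1)) ℝ :=
  Matrix.of fun k => Fin.cons (-b k) (M k)

/-- `W_x`: the matrix `W` without its first row and first column. -/
def dropFirst {d : ℕ} (W : Matrix (Fin (d + 1)) (Fin (d + 1)) ℝ) : Matrix (Fin d) (Fin d) ℝ :=
  W.submatrix Fin.succ Fin.succ

/-- `W` is feasible for the semidefinite program (SILS-SDP). -/
structure SDPFeasible {d : ℕ} (σ : ℕ) (W : Matrix (Fin (d + 1)) (Fin (d + 1)) ℝ) : Prop where
  posSemidef : W.PosSemidef
  corner : W 0 0 = 1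
  trace_eq : (dropFirst W).trace = σ
  sum_abs_le : ∑ i, ∑ j, |dropFirst W i j| ≤ (σ : ℝ) ^ 2
  diag_le : ∀ i, dropFirst W i i ≤ 1

/-- The objective `(1/n) tr(Aᵀ A W)` of (SILS-SDP). -/
noncomputable def sdpCost {n d : ℕ} (M : Matrix (Fin n) (Fin d) ℝ) (b : Fin n → ℝ)
    (W : Matrix (Fin (d + 1)) (Fin (d + 1)) ℝ) : ℝ :=
  (1 / (n : ℝ)) * ((sdpData M b)ᵀ * sdpData M b * W).trace

/-- `W` is an optimal solution of (SILS-SDP). -/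
def SDPOptimal {n d : ℕ} (M : Matrix (Fin n) (Fin d) ℝ) (b : Fin n → ℝ) (σ : ℕ)
    (W : Matrix (Fin (d + 1)) (Fin (d + 1)) ℝ) : Prop :=
  SDPFeasible σ W ∧ ∀ V, SDPFeasible σ V → sdpCost M b W ≤ sdpCost M b V

/-- The rank-one matrix `(1, x) (1, x)ᵀ`. -/
def rankOneLift {d : ℕ} (x : Fin d → ℝ) : Matrix (Fin (d + 1)) (Fin (d + 1)) ℝ :=
  Matrix.vecMulVec (Fin.cons 1 x) (Fin.cons 1 x)

/-- (SILS-SDP) recovers `x`: `x ∈ {0, ±1}^d`, and `(1, x) (1, x)ᵀ` is the unique optimal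
solution of (SILS-SDP). -/
def SDPRecovers {n d : ℕ} (M : Matrix (Fin n) (Fin d) ℝ) (b : Fin n → ℝ) (σ : ℕ)
    (x : Fin d → ℝ) : Prop :=
  (∀ i, x i = 0 ∨ x i = 1 ∨ x i = -1) ∧ ∀ W, SDPOptimal M b σ W ↔ W = rankOneLift x

/-- (SILS-SDP) solves (SILS): it recovers some vector `x`, and this vector is optimal for (SILS).
(The second part is a consequence of the first, as (SILS-SDP) is a relaxation of (SILS).) -/
def SDPSolvesSILS {n d : ℕ} (M : Matrix (Fin n) (Fin d) ℝ) (b : Fin n → ℝ) (σ : ℕ) : Prop :=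
  ∃ x : Fin d → ℝ, SDPRecovers M b σ x ∧ SILSOptimal M b σ x

/-- `X ∼ SG(v)`: `E exp(t (X - E X)) ≤ exp(v t² / 2)` for all real `t`
(finiteness of the left-hand side included). -/
def IsSG {Ω : Type*} [MeasurableSpace Ω] (X : Ω → ℝ) (v : ℝ≥0) (μ : Measure Ω) : Prop :=
  HasSubgaussianMGF (fun ω => X ω - ∫ ω', X ω' ∂μ) v μ

/-- The random data of the model: a matrix `M` with i.i.d. centered entries of law `SG(1)`,
normalized to have variance one; a deterministic ground truth `z` with entries `±2` on the first
`σ` coordinates and `±1` elsewhere; and a noise vector `ε`, independent of `M`, with i.i.d.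
centered entries of law `SG(ϱ²)`. -/
structure FeatureModel {Ω : Type*} [MeasurableSpace Ω] (μ : Measure Ω) {n d : ℕ} (σ : ℕ)
    (ϱ : ℝ≥0) (M : Ω → Matrix (Fin n) (Fin d) ℝ) (z : Fin d → ℝ) (ε : Ω → Fin n → ℝ) : Prop where
  measurable_M : ∀ k i, Measurable fun ω => M ω k i
  indep_M : iIndepFun (fun (p : Fin n × Fin d) ω => M ω p.1 p.2) μ
  ident_M : ∀ k i l j, IdentDistrib (fun ω => M ω k i) (fun ω => M ω l j) μ μ
  centered_M : ∀ k i, ∫ ω, M ω k i ∂μ = 0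
  variance_M : ∀ k i, variance (fun ω => M ω k i) μ = 1
  subG_M : ∀ k i, IsSG (fun ω => M ω k i) 1 μ
  z_head : ∀ i : Fin d, (i : ℕ) < σ → z i = 2 ∨ z i = -2
  z_tail : ∀ i : Fin d, σ ≤ (i : ℕ) → z i = 1 ∨ z i = -1
  measurable_ε : ∀ k, Measurable fun ω => ε ω k
  indep_ε : iIndepFun (fun (k : Fin n) ω => ε ω k) μ
  ident_ε : ∀ k l, IdentDistrib (fun ω => ε ω k) (fun ω => ε ω l) μ μ
  centered_ε : ∀ k, ∫ ω, ε ω k ∂μ = 0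
  subG_ε : ∀ k, IsSG (fun ω => ε ω k) (ϱ ^ 2) μ
  indep_M_ε : IndepFun (fun ω (p : Fin n × Fin d) => M ω p.1 p.2) ε μ

/-!
Let `x` carry the signs of `z` on the first `σ` coordinates and vanish elsewhere. For a feasible
`W` with first row `(1, w)`, put `g = ∑ xᵢ (xᵢ - wᵢ)`. Feasibility alone makes `g` control all
deviations of `W` from the lift of `x` (`SDPFeasible.gap_bounds`): by the Schur complement,
`‖w‖₁ ≤ σ` and `xᵀ W_x x ≥ (σ - g)²`, so that `z · (x - w) ≥ g`, `‖w - x‖₁ ≤ 2 g`, and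
`∑ |W_x - x xᵀ| ≤ 4 σ g`; in particular `g > 0` unless `W` is the lift itself.

The cost of `W` minus that of the lift is, up to the factor `1/n`,
`2 (Mᵀb) · (x - w) + ⟨MᵀM, W_x - x xᵀ⟩`. If `MᵀM / n` and `Mᵀb / n` were `I` and `z`, this would be
`2 n z · (x - w) ≥ 2 n g`, the trace being fixed. Since errors are measured in `ℓ¹`, entrywise errors
of `1 / (16 σ)` in `MᵀM / n` and of `1 / 4` in `Mᵀb / n` are affordable; this is
`SDPSolvesSILS.of_entrywise_close`, and no spectral information on `M` is needed.

Both entrywise bounds hold with probability at least `1 - 4 / d` by Chernoff's bound and a union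
bound. An off-diagonal entry of `MᵀM`, and an entry of `Mᵀb` without its diagonal contribution,
is the correlation of a column of `M` with an independent sub-Gaussian vector, of variance proxy
`1` and at most `4 d + ϱ²` respectively; its exponential moment is reduced to that of the squared
norm of the column (`lintegral_exp_column_correlation_le`), which Gaussian linearization controls
(`lintegral_exp_sq_le`). The diagonal of `MᵀM` is a sum of centered squares
(`lintegral_exp_centered_sq_le`). The tails `exp (-c n / σ²)` and `exp (-c n / (d + ϱ²))` are where
the hypothesis on `n` enters.
-/

/-! ### The semidefinite relaxation and its feasible set -/

section Relaxation

variable {n d : ℕ}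

/-- The cost of a Hermitian matrix, expanded into blocks: corner, first row, and `W_x`. -/
theorem mul_sdpCost (hn : 0 < n) (M : Matrix (Fin n) (Fin d) ℝ) (b : Fin n → ℝ)
    {W : Matrix (Fin (d + 1)) (Fin (d + 1)) ℝ} (hW : W.IsHermitian) :
    n * sdpCost M b W = W 0 0 * (b ⬝ᵥ b) - 2 * ∑ i, (Mᵀ *ᵥ b) i * W 0 (Fin.succ i)
      + ∑ i, ∑ j, (Mᵀ * M) i j * dropFirst W i j := by
  have hn' : (n : ℝ) ≠ 0 := by positivity
  have hsymm : ∀ i j, W i j = W j i := fun i j => by simpa using hW.apply j i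
  have e1 : ∀ i j, ((sdpData M b)ᵀ * sdpData M b) i j
      = (fun k => sdpData M b k i) ⬝ᵥ (fun k => sdpData M b k j) := fun i j => rfl
  rw [sdpCost, ← mul_assoc, mul_one_div_cancel hn', one_mul]
  have e0 : ∀ P : Matrix (Fin (d + 1)) (Fin (d + 1)) ℝ,
      (P * W).trace = ∑ i, ∑ j, P i j * W j i := fun P => rfl
  simp only [e0, e1, Fin.sum_univ_succ]
  have a0 : (fun k => sdpData M b k 0) = -b := by ext k; simp [sdpData]
  have a1 : ∀ i : Fin d, (fun k => sdpData M b k i.succ) = fun k => M k i := fun i => by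
    ext k; simp [sdpData]
  have a2 : ∀ i : Fin d, (fun k => M k i) ⬝ᵥ b = (Mᵀ *ᵥ b) i := fun i => rfl
  have a3 : ∀ i j : Fin d, (fun k => M k i) ⬝ᵥ (fun k => M k j) = (Mᵀ * M) i j := fun i j => rfl
  simp only [a0, a1, neg_dotProduct, dotProduct_neg, a2, a3, dotProduct_comm b,
    Finset.sum_add_distrib, neg_neg, neg_mul, Finset.sum_neg_distrib, hsymm (Fin.succ _) 0]
  have a4 : ∀ i j, (Mᵀ * M) i j * W j.succ i.succ = (Mᵀ * M) i j * dropFirst W i j := fun i j => by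
    rw [hsymm]; rfl
  simp only [a4]
  ring

theorem SDPFeasible.abs_le_one {σ : ℕ} {W : Matrix (Fin (d + 1)) (Fin (d + 1)) ℝ}
    (hW : SDPFeasible σ W) (i j : Fin d) : |dropFirst W i j| ≤ 1 := by
  have hP : (dropFirst W).PosSemidef := hW.posSemidef.submatrix _
  have hs : dropFirst W j i = dropFirst W i j := by simpa using hP.isHermitian.apply i j
  have h := fun t : ℝ => hP.dotProduct_mulVec_nonneg (Pi.single i 1 + t • Pi.single j 1)
  have e : ∀ t : ℝ, star (Pi.single i 1 + t • Pi.single j 1 : Fin d → ℝ) ⬝ᵥ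
      (dropFirst W *ᵥ (Pi.single i 1 + t • Pi.single j 1))
      = dropFirst W i i + 2 * t * dropFirst W i j + t ^ 2 * dropFirst W j j := fun t => by
    simp [Matrix.mulVec_add, Matrix.mulVec_smul, add_dotProduct, dotProduct_add,
      smul_dotProduct, dotProduct_smul, hs]
    ring
  have h1 := h 1
  have h2 := h (-1)
  rw [e] at h1 h2
  have := hW.diag_le i
  have := hW.diag_le j
  rw [abs_le]
  constructor <;> linarith

theorem SDPFeasible.abs_row_le_one {σ : ℕ} {W : Matrix (Fin (d + 1)) (Fin (d + 1)) ℝ}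
    (hW : SDPFeasible σ W) (i : Fin d) : |W 0 i.succ| ≤ 1 := by
  have hP := hW.posSemidef
  have hs : W i.succ 0 = W 0 i.succ := by simpa using hP.isHermitian.apply 0 i.succ
  have h := fun t : ℝ => hP.dotProduct_mulVec_nonneg (Pi.single 0 1 + t • Pi.single i.succ 1)
  have e : ∀ t : ℝ, star (Pi.single 0 1 + t • Pi.single i.succ 1 : Fin (d + 1) → ℝ) ⬝ᵥ
      (W *ᵥ (Pi.single 0 1 + t • Pi.single i.succ 1))
      = W 0 0 + 2 * t * W 0 i.succ + t ^ 2 * W i.succ i.succ := fun t => by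
    simp [Matrix.mulVec_add, Matrix.mulVec_smul, add_dotProduct, dotProduct_add,
      smul_dotProduct, dotProduct_smul, hs]
    ring
  have h1 := h 1
  have h2 := h (-1)
  rw [e, hW.corner] at h1 h2
  have : W i.succ i.succ ≤ 1 := hW.diag_le i
  rw [abs_le]
  constructor <;> linarith

/-- The Schur complement inequality `W_x ⪰ w wᵀ`, where `w` is the first row of `W` without its
corner. -/
theorem SDPFeasible.sq_dotProduct_le {σ : ℕ} {W : Matrix (Fin (d + 1)) (Fin (d + 1)) ℝ}
    (hW : SDPFeasible σ W) (y : Fin d → ℝ) :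
    (∑ i, y i * W 0 i.succ) ^ 2 ≤ ∑ i, ∑ j, y i * y j * dropFirst W i j := by
  have hP := hW.posSemidef
  have hs : ∀ i : Fin d, W i.succ 0 = W 0 i.succ := fun i => by
    simpa using hP.isHermitian.apply 0 i.succ
  set c := ∑ i, y i * W 0 i.succ with hc
  have h := hP.dotProduct_mulVec_nonneg (Fin.cons (-c) y)
  have e : star (Fin.cons (-c) y : Fin (d + 1) → ℝ) ⬝ᵥ (W *ᵥ (Fin.cons (-c) y))
      = c ^ 2 * W 0 0 - 2 * c * (∑ i, y i * W 0 i.succ)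
        + ∑ i, ∑ j, y i * y j * dropFirst W i j := by
    simp only [dotProduct, Matrix.mulVec, Fin.sum_univ_succ, Pi.star_apply, Fin.cons_zero,
      Fin.cons_succ, star_trivial, mul_add, Finset.sum_add_distrib, hs]
    have e1 : ∑ i : Fin d, y i * ∑ j : Fin d, W i.succ j.succ * y j
        = ∑ i, ∑ j, y i * y j * dropFirst W i j := by
      refine Finset.sum_congr rfl fun i _ => ?_
      rw [Finset.mul_sum]
      exact Finset.sum_congr rfl fun j _ => by simp only [dropFirst, Matrix.submatrix_apply]; ring
    have e2 : ∑ i : Fin d, y i * (W 0 i.succ * -c) = -c * ∑ i, y i * W 0 i.succ := by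
      rw [Finset.mul_sum]; exact Finset.sum_congr rfl fun i _ => by ring
    have e3 : ∑ i : Fin d, W 0 i.succ * y i = ∑ i, y i * W 0 i.succ :=
      Finset.sum_congr rfl fun i _ => by ring
    rw [e1, e2, e3]
    ring
  rw [e, hW.corner, ← hc] at h
  linarith

theorem SDPFeasible.sum_abs_row_le {σ : ℕ} {W : Matrix (Fin (d + 1)) (Fin (d + 1)) ℝ}
    (hW : SDPFeasible σ W) : ∑ i : Fin d, |W 0 i.succ| ≤ σ := by
  -- the Schur complement inequality, tested on the signs of the first row
  have h := hW.sq_dotProduct_le fun i => SignType.sign (W 0 i.succ)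
  simp only [sign_mul_self] at h
  have hs : ∀ a : ℝ, |(SignType.sign a : ℝ)| ≤ 1 := fun a => by
    rcases lt_trichotomy a 0 with h | h | h <;> simp [h]
  have h2 : ∑ i, ∑ j, (SignType.sign (W 0 (Fin.succ i)) : ℝ) * SignType.sign (W 0 (Fin.succ j))
      * dropFirst W i j ≤ ∑ i, ∑ j, |dropFirst W i j| := by
    refine Finset.sum_le_sum fun i _ => Finset.sum_le_sum fun j _ => ?_
    refine (le_abs_self _).trans ?_
    rw [abs_mul, abs_mul]
    exact mul_le_of_le_one_left (abs_nonneg _) (mul_le_one₀ (hs _) (abs_nonneg _) (hs _))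
  exact abs_le_of_sq_le_sq' (h.trans (h2.trans hW.sum_abs_le)) (Nat.cast_nonneg _) |>.2

theorem rankOneLift_feasible {σ : ℕ} {x : Fin d → ℝ} (hx : SILSFeasible σ x) :
    SDPFeasible σ (rankOneLift x) := by
  have hd : ∀ i j, dropFirst (rankOneLift x) i j = x i * x j := fun i j => by
    simp [dropFirst, rankOneLift, Matrix.vecMulVec_apply]
  have hsum : ∀ f : ℝ → ℝ, f 0 = 0 → f 1 = 1 → f (-1) = 1 → ∑ i, f (x i) = σ := by
    intro f h0 h1 h2
    rw [← hx.card_support, Finset.card_filter, Nat.cast_sum]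
    refine Finset.sum_congr rfl fun i _ => ?_
    rcases hx.entries i with h | h | h <;> simp [h, h0, h1, h2]
  refine ⟨?_, ?_, ?_, ?_, ?_⟩
  · simpa [rankOneLift] using Matrix.posSemidef_vecMulVec_self_star (Fin.cons 1 x : Fin (d + 1) → ℝ)
  · simp [rankOneLift, Matrix.vecMulVec_apply]
  · simp only [Matrix.trace, Matrix.diag, hd]
    exact hsum (fun t => t * t) (by simp) (by simp) (by simp)
  · simp only [hd, abs_mul, ← Finset.mul_sum, ← Finset.sum_mul]
    rw [hsum (fun t => |t|) (by simp) (by simp) (by simp), sq]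
  · intro i
    rw [hd]
    rcases hx.entries i with h | h | h <;> simp [h]

theorem sdpCost_rankOneLift (M : Matrix (Fin n) (Fin d) ℝ) (b : Fin n → ℝ) (x : Fin d → ℝ) :
    sdpCost M b (rankOneLift x) = silsCost M b x := by
  have h : sdpData M b *ᵥ (Fin.cons 1 x) = M *ᵥ x - b := by
    ext k
    simp [sdpData, Matrix.mulVec, dotProduct, Fin.sum_univ_succ]
    ring
  rw [sdpCost, silsCost, rankOneLift, Matrix.mul_vecMulVec, Matrix.trace_vecMulVec,
    ← Matrix.mulVec_mulVec, h, Matrix.mulVec_transpose, ← Matrix.dotProduct_mulVec, h]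
  simp [dotProduct, sq]

/-- `x` is recovered when its lift is feasible and cheaper than every other feasible matrix. -/
theorem SDPSolvesSILS.of_lt {σ : ℕ} {M : Matrix (Fin n) (Fin d) ℝ} {b : Fin n → ℝ} {x : Fin d → ℝ}
    (hx : SILSFeasible σ x)
    (h : ∀ W, SDPFeasible σ W → W ≠ rankOneLift x → sdpCost M b (rankOneLift x) < sdpCost M b W) :
    SDPSolvesSILS M b σ := by
  have hf := rankOneLift_feasible hx
  have hle : ∀ V, SDPFeasible σ V → sdpCost M b (rankOneLift x) ≤ sdpCost M b V := fun V hV => by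
    by_cases hVx : V = rankOneLift x
    · rw [hVx]
    · exact (h V hV hVx).le
  refine ⟨x, ⟨hx.entries, fun W => ⟨fun hW => ?_, fun hW => ?_⟩⟩, hx, fun y hy => ?_⟩
  · by_contra hne
    exact absurd (hW.2 _ hf) (not_le.2 (h W hW.1 hne))
  · rw [hW]; exact ⟨hf, hle⟩
  · rw [← sdpCost_rankOneLift, ← sdpCost_rankOneLift]
    exact hle _ (rankOneLift_feasible hy)

end Relaxation

/-! ### Recovery under entrywise concentration -/

section Deterministic

variable {n d : ℕ}

/-- The gap `g = ∑ xᵢ (xᵢ - wᵢ)` of a feasible matrix, with `w` its first row, controls both its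
entrywise `ℓ¹` distance to the lift of `x` and the loss of correlation with `z`. -/
theorem SDPFeasible.gap_bounds {σ : ℕ} {W : Matrix (Fin (d + 1)) (Fin (d + 1)) ℝ}
    (hW : SDPFeasible σ W) {x z : Fin d → ℝ} (hx : SILSFeasible σ x)
    (hz : ∀ i, (x i = 0 ∧ |z i| ≤ 1) ∨ (x i = 1 ∧ z i = 2) ∨ (x i = -1 ∧ z i = -2))
    {g : ℝ} (hg : g = ∑ i, x i * (x i - W 0 i.succ)) :
    g ≤ ∑ i, z i * (x i - W 0 i.succ) ∧ ∑ i, |W 0 i.succ - x i| ≤ 2 * g ∧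
      ∑ i, ∑ j, |dropFirst W i j - x i * x j| ≤ 4 * σ * g := by
  have hsq : ∑ i, x i ^ 2 = σ := by
    rw [← hx.card_support, Finset.card_filter, Nat.cast_sum]
    refine Finset.sum_congr rfl fun i _ => ?_
    rcases hx.entries i with h | h | h <;> simp [h]
  have hg' : g = σ - ∑ i, x i * W 0 i.succ := by
    rw [hg, ← hsq, ← Finset.sum_sub_distrib]
    exact Finset.sum_congr rfl fun i _ => by ring
  have hrow := hW.sum_abs_row_le
  have hr := hW.abs_row_le_one
  -- `∑ |wᵢ| ≤ σ` leaves only `g` of slack in `xᵢ wᵢ ≤ |wᵢ|`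
  have hslack : ∑ i, (|W 0 i.succ| - x i * W 0 i.succ) ≤ g := by
    rw [Finset.sum_sub_distrib]; linarith
  refine ⟨?_, ?_, ?_⟩
  · have h : ∑ i, (2 * (x i * (x i - W 0 i.succ)) - (|W 0 i.succ| - x i * W 0 i.succ))
        ≤ ∑ i, z i * (x i - W 0 i.succ) := by
      refine Finset.sum_le_sum fun i _ => ?_
      rcases hz i with ⟨h, h'⟩ | ⟨h, h'⟩ | ⟨h, h'⟩
      · rw [h]
        have := abs_mul (z i) (W 0 i.succ)
        have := le_abs_self (z i * W 0 i.succ)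
        have := mul_le_mul_of_nonneg_right h' (abs_nonneg (W 0 i.succ))
        linarith
      · rw [h, h']; linarith [le_abs_self (W 0 i.succ)]
      · rw [h, h']; linarith [neg_abs_le (W 0 i.succ)]
    rw [Finset.sum_sub_distrib, ← Finset.mul_sum, ← hg] at h
    linarith
  · have h : ∑ i, |W 0 i.succ - x i|
        ≤ ∑ i, (x i * (x i - W 0 i.succ) + (|W 0 i.succ| - x i * W 0 i.succ)) := by
      refine Finset.sum_le_sum fun i _ => ?_
      have hi := abs_le.1 (hr i)
      rcases hx.entries i with h | h | h
      · simp [h]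
      · rw [h, abs_of_nonpos (by linarith)]; linarith [le_abs_self (W 0 i.succ)]
      · rw [h, abs_of_nonneg (by linarith)]; linarith [neg_abs_le (W 0 i.succ)]
    rw [Finset.sum_add_distrib, ← hg] at h
    linarith
  · have h : ∑ i, ∑ j, |dropFirst W i j - x i * x j|
        ≤ ∑ i, ∑ j, (x i ^ 2 * x j ^ 2 + |dropFirst W i j|
            - 2 * (x i * x j * dropFirst W i j)) := by
      refine Finset.sum_le_sum fun i _ => Finset.sum_le_sum fun j _ => ?_
      have hij := abs_le.1 (hW.abs_le_one i j)
      have h1 := le_abs_self (dropFirst W i j)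
      have h2 := neg_abs_le (dropFirst W i j)
      have hxx : x i * x j = 0 ∨ x i * x j = 1 ∨ x i * x j = -1 := by
        rcases hx.entries i with h | h | h <;> rcases hx.entries j with h' | h' | h' <;>
          simp [h, h']
      rw [← mul_pow]
      rcases hxx with h | h | h
      · simp [h]
      · rw [h, abs_of_nonpos (by linarith)]; linarith
      · rw [h, abs_of_nonneg (by linarith)]; linarith
    simp only [Finset.sum_sub_distrib, Finset.sum_add_distrib, ← Finset.mul_sum,
      ← Finset.sum_mul, hsq] at h
    have hq := hW.sq_dotProduct_le x
    have ha := hW.sum_abs_le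
    have hs : ∑ i, x i * W 0 i.succ = σ - g := by linarith
    -- `σ² - (σ - g)² ≤ 2 σ g`
    rw [hs] at hq
    nlinarith [sq_nonneg g]

/-- Deterministic recovery: if `MᵀM / n` and `Mᵀb / n` are entrywise close to the identity and to
`z`, the first one within `O(1/σ)` and the second one within a constant, then (SILS-SDP) recovers
the signs of `z` on the coordinates where `|zᵢ| = 2`. -/
theorem SDPSolvesSILS.of_entrywise_close {σ : ℕ} (hn : 0 < n) (hσ : 0 < σ)
    {M : Matrix (Fin n) (Fin d) ℝ} {b : Fin n → ℝ} {x z : Fin d → ℝ} (hx : SILSFeasible σ x)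
    (hz : ∀ i, (x i = 0 ∧ |z i| ≤ 1) ∨ (x i = 1 ∧ z i = 2) ∨ (x i = -1 ∧ z i = -2))
    (hG : ∀ i j, |(Mᵀ * M) i j - n * (1 : Matrix (Fin d) (Fin d) ℝ) i j| ≤ n * (1 / (16 * σ)))
    (hb : ∀ i, |(Mᵀ *ᵥ b) i - n * z i| ≤ n / 4) : SDPSolvesSILS M b σ := by
  have hn' : (0 : ℝ) < n := by exact_mod_cast hn
  have hσ' : (0 : ℝ) < σ := by exact_mod_cast hσ
  refine .of_lt hx fun W hW hne => ?_
  obtain ⟨g, hg⟩ : ∃ g, g = ∑ i, x i * (x i - W 0 i.succ) := ⟨_, rfl⟩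
  obtain ⟨h1, h2, h3⟩ := hW.gap_bounds hx hz hg
  have hf := rankOneLift_feasible hx
  have hx0 : ∀ i : Fin d, rankOneLift x 0 i.succ = x i := fun i => by
    simp [rankOneLift, Matrix.vecMulVec_apply]
  have hxx : ∀ i j, dropFirst (rankOneLift x) i j = x i * x j := fun i j => by
    simp [dropFirst, rankOneLift, Matrix.vecMulVec_apply]
  have hgpos : 0 < g := by
    have h0 : 0 ≤ ∑ i, |W 0 i.succ - x i| := Finset.sum_nonneg fun _ _ => abs_nonneg _
    refine lt_of_le_of_ne (by linarith) fun h => hne ?_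
    rw [← h, mul_zero] at h2 h3
    have e1 : ∀ i : Fin d, W 0 i.succ = x i := fun i => by
      have := (Finset.sum_eq_zero_iff_of_nonneg fun _ _ => abs_nonneg _).1 (le_antisymm h2 h0) i
        (Finset.mem_univ i)
      exact sub_eq_zero.1 (abs_eq_zero.1 this)
    have e2 : ∀ i j : Fin d, dropFirst W i j = x i * x j := fun i j => by
      have h0' : 0 ≤ ∑ i, ∑ j, |dropFirst W i j - x i * x j| :=
        Finset.sum_nonneg fun _ _ => Finset.sum_nonneg fun _ _ => abs_nonneg _
      have := (Finset.sum_eq_zero_iff_of_nonneg fun _ _ =>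
        Finset.sum_nonneg fun _ _ => abs_nonneg _).1 (le_antisymm h3 h0') i (Finset.mem_univ i)
      have := (Finset.sum_eq_zero_iff_of_nonneg fun _ _ => abs_nonneg _).1 this j
        (Finset.mem_univ j)
      exact sub_eq_zero.1 (abs_eq_zero.1 this)
    have hs : ∀ i : Fin d, W i.succ 0 = W 0 i.succ := fun i => by
      simpa using hW.posSemidef.isHermitian.apply 0 i.succ
    ext i j
    refine Fin.cases ?_ (fun i => ?_) i <;> refine Fin.cases ?_ (fun j => ?_) j
    · rw [hW.corner, hf.corner]
    · rw [e1, hx0]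
    · rw [hs, e1]; simp [rankOneLift, Matrix.vecMulVec_apply]
    · exact (e2 i j).trans (hxx i j).symm
  have c1 := mul_sdpCost hn M b hW.posSemidef.isHermitian
  have c2 := mul_sdpCost hn M b hf.posSemidef.isHermitian
  rw [hW.corner] at c1
  simp only [hf.corner, hx0, hxx] at c2
  -- the identity part of `MᵀM` does not see `W_x - x xᵀ`, as both traces equal `σ`
  have htr : ∑ i, ∑ j, (n * (1 : Matrix (Fin d) (Fin d) ℝ) i j) * (dropFirst W i j - x i * x j)
      = 0 := by
    have t1 := hW.trace_eq
    have t2 := hf.trace_eq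
    simp only [Matrix.trace, Matrix.diag, hxx] at t1 t2
    simp [Matrix.one_apply, ← Finset.mul_sum, t1, t2]
  have hquad : -(n * (1 / (16 * σ)) * (4 * σ * g))
      ≤ ∑ i, ∑ j, ((Mᵀ * M) i j - n * (1 : Matrix (Fin d) (Fin d) ℝ) i j)
          * (dropFirst W i j - x i * x j) := by
    refine (neg_le_neg (mul_le_mul_of_nonneg_left h3 (by positivity))).trans ?_
    rw [Finset.mul_sum, ← Finset.sum_neg_distrib]
    refine Finset.sum_le_sum fun i _ => ?_
    rw [Finset.mul_sum, ← Finset.sum_neg_distrib]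
    refine Finset.sum_le_sum fun j _ => ?_
    refine le_trans (neg_le_neg ?_) (neg_abs_le _)
    rw [abs_mul]
    exact mul_le_mul_of_nonneg_right (hG i j) (abs_nonneg _)
  have hlin : ∑ i, ((Mᵀ *ᵥ b) i - n * z i) * (W 0 (Fin.succ i) - x i) ≤ n / 4 * (2 * g) := by
    refine le_trans ?_ (mul_le_mul_of_nonneg_left h2 (by positivity))
    rw [Finset.mul_sum]
    refine Finset.sum_le_sum fun i _ => (le_abs_self _).trans ?_
    rw [abs_mul]
    exact mul_le_mul_of_nonneg_right (hb i) (abs_nonneg _)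
  have hconst : (n : ℝ) * (1 / (16 * σ)) * (4 * σ * g) = n * g / 4 := by field_simp; norm_num
  have hdec : ∑ i, ((Mᵀ *ᵥ b) i - n * z i) * (W 0 (Fin.succ i) - x i)
      = ∑ i, (Mᵀ *ᵥ b) i * W 0 (Fin.succ i) - ∑ i, (Mᵀ *ᵥ b) i * x i
        + n * ∑ i, z i * (x i - W 0 (Fin.succ i)) := by
    rw [Finset.mul_sum, ← Finset.sum_sub_distrib, ← Finset.sum_add_distrib]
    exact Finset.sum_congr rfl fun i _ => by ring
  have hdec2 : ∑ i, ∑ j, ((Mᵀ * M) i j - n * (1 : Matrix (Fin d) (Fin d) ℝ) i j)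
          * (dropFirst W i j - x i * x j)
      = ∑ i, ∑ j, (Mᵀ * M) i j * dropFirst W i j - ∑ i, ∑ j, (Mᵀ * M) i j * (x i * x j) := by
    rw [← sub_zero (_ - _), ← htr]
    simp only [← Finset.sum_sub_distrib]
    exact Finset.sum_congr rfl fun i _ => Finset.sum_congr rfl fun j _ => by ring
  have hng : (n : ℝ) * g ≤ n * ∑ i, z i * (x i - W 0 (Fin.succ i)) :=
    mul_le_mul_of_nonneg_left h1 hn'.le
  have hpos : 0 < n * g := mul_pos hn' hgpos
  refine lt_of_mul_lt_mul_left (a := (n : ℝ)) ?_ hn'.le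
  linarith

end Deterministic

/-! ### Exponential moments and Chernoff bounds -/

section ExponentialMoments

variable {Ω : Type*} [MeasurableSpace Ω] {μ : Measure Ω}

theorem lintegral_exp_mul_le {X : Ω → ℝ} {c : ℝ≥0} (hX : HasSubgaussianMGF X c μ) (t : ℝ) :
    ∫⁻ ω, ENNReal.ofReal (Real.exp (t * X ω)) ∂μ ≤ ENNReal.ofReal (Real.exp (c * t ^ 2 / 2)) := by
  rw [← ofReal_integral_eq_lintegral_ofReal (hX.integrable_exp_mul t)
    (Filter.Eventually.of_forall fun _ => (Real.exp_pos _).le)]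
  exact ENNReal.ofReal_le_ofReal (hX.mgf_le t)

theorem lintegral_exp_sum_le {ι : Type*} [Fintype ι] {X : ι → Ω → ℝ} (hind : iIndepFun X μ)
    (hX : ∀ i, Measurable (X i)) {f : ι → ℝ → ℝ} (hf : ∀ i, Measurable (f i)) {c : ι → ℝ}
    (h : ∀ i, ∫⁻ ω, ENNReal.ofReal (Real.exp (f i (X i ω))) ∂μ
      ≤ ENNReal.ofReal (Real.exp (c i))) :
    ∫⁻ ω, ENNReal.ofReal (Real.exp (∑ i, f i (X i ω))) ∂μ
      ≤ ENNReal.ofReal (Real.exp (∑ i, c i)) := by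
  have hm : ∀ i, Measurable fun x => ENNReal.ofReal (Real.exp (f i x)) := fun i =>
    (Real.measurable_exp.comp (hf i)).ennreal_ofReal
  have := lintegral_prod_eq_prod_lintegral_of_indepFun Finset.univ _
    (hind.comp (fun i x => ENNReal.ofReal (Real.exp (f i x))) hm) (fun i => (hm i).comp (hX i))
  simp only [Real.exp_sum, ENNReal.ofReal_prod_of_nonneg fun _ _ => (Real.exp_pos _).le]
  exact this.le.trans (Finset.prod_le_prod' fun i _ => h i)

theorem lintegral_exp_linear_le {ι : Type*} [Fintype ι] {X : ι → Ω → ℝ} (hind : iIndepFun X μ)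
    (hX : ∀ i, Measurable (X i)) {c : ℝ≥0} (hsub : ∀ i, HasSubgaussianMGF (X i) c μ)
    (a : ι → ℝ) :
    ∫⁻ ω, ENNReal.ofReal (Real.exp (∑ i, a i * X i ω)) ∂μ
      ≤ ENNReal.ofReal (Real.exp (c * (∑ i, a i ^ 2) / 2)) := by
  rw [Finset.mul_sum, Finset.sum_div]
  exact lintegral_exp_sum_le hind hX (fun i => measurable_const_mul (a i))
    fun i => lintegral_exp_mul_le (hsub i) (a i)

/-- Integrating out the second of two independent variables. -/
theorem lintegral_comp_le_of_indepFun [IsProbabilityMeasure μ] {α β : Type*} [MeasurableSpace α]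
    [MeasurableSpace β] {X : Ω → α} {Y : Ω → β} (hind : IndepFun X Y μ) (hX : Measurable X)
    (hY : Measurable Y) {f : α × β → ENNReal} (hf : Measurable f) {g : α → ENNReal}
    (hg : Measurable g) (h : ∀ x, ∫⁻ ω, f (x, Y ω) ∂μ ≤ g x) :
    ∫⁻ ω, f (X ω, Y ω) ∂μ ≤ ∫⁻ ω, g (X ω) ∂μ := by
  have : IsProbabilityMeasure (μ.map Y) := Measure.isProbabilityMeasure_map hY.aemeasurable
  rw [← lintegral_map hf (hX.prodMk hY),
    (indepFun_iff_map_prod_eq_prod_map_map hX.aemeasurable hY.aemeasurable).1 hind,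
    lintegral_prod _ hf.aemeasurable, ← lintegral_map hg hX]
  refine lintegral_mono fun x => ?_
  rw [lintegral_map (f := fun y => f (x, y)) (hf.comp measurable_prodMk_left) hY]
  exact h x

theorem lintegral_exp_neg_mul_sq {b : ℝ} (hb : 0 < b) :
    ∫⁻ x : ℝ, ENNReal.ofReal (Real.exp (-b * x ^ 2)) = ENNReal.ofReal √(Real.pi / b) := by
  rw [← integral_gaussian, ofReal_integral_eq_lintegral_ofReal (integrable_exp_neg_mul_sq hb)
    (Filter.Eventually.of_forall fun _ => (Real.exp_pos _).le)]

/-- Linearization of a square by a Gaussian integral. -/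
theorem lintegral_exp_mul_sub_half_sq (s : ℝ) :
    ∫⁻ x : ℝ, ENNReal.ofReal (Real.exp (s * x - x ^ 2 / 2))
      = ENNReal.ofReal √(2 * Real.pi) * ENNReal.ofReal (Real.exp (s ^ 2 / 2)) := by
  have h : ∀ x : ℝ, ENNReal.ofReal (Real.exp (s * x - x ^ 2 / 2))
      = ENNReal.ofReal (Real.exp (-(1 / 2) * (x - s) ^ 2)) * ENNReal.ofReal (Real.exp (s ^ 2 / 2)) := by
    intro x
    rw [← ENNReal.ofReal_mul (Real.exp_pos _).le, ← Real.exp_add]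
    ring_nf
  simp_rw [h]
  rw [lintegral_mul_const' _ _ ENNReal.ofReal_ne_top,
    lintegral_sub_right_eq_self (fun x : ℝ => ENNReal.ofReal (Real.exp (-(1 / 2) * x ^ 2))) s,
    lintegral_exp_neg_mul_sq (by norm_num)]
  congr 3
  ring

/-- The exponential moment of the square of a sub-Gaussian variable is bounded by its Gaussian
value `(1 - u)^(-1/2)`, hence by `exp u` for `u ≤ 1/2`. -/
theorem lintegral_exp_sq_le [IsProbabilityMeasure μ] {X : Ω → ℝ} (hXm : Measurable X)
    (hX : HasSubgaussianMGF X 1 μ) {u : ℝ} (h0 : 0 ≤ u) (hu : u ≤ 1 / 2) :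
    ∫⁻ ω, ENNReal.ofReal (Real.exp (u / 2 * X ω ^ 2)) ∂μ ≤ ENNReal.ofReal (Real.exp u) := by
  have hpi := Real.pi_pos
  have hne : ENNReal.ofReal √(2 * Real.pi) ≠ 0 := by
    simp [ENNReal.ofReal_eq_zero, not_le]; positivity
  refine (ENNReal.mul_le_mul_iff_right hne ENNReal.ofReal_ne_top).1 ?_
  have key : ENNReal.ofReal √(2 * Real.pi) *
      ∫⁻ ω, ENNReal.ofReal (Real.exp (u / 2 * X ω ^ 2)) ∂μ
      = ∫⁻ ω, ∫⁻ x : ℝ, ENNReal.ofReal (Real.exp ((√u * X ω) * x - x ^ 2 / 2)) ∂volume ∂μ := by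
    rw [← lintegral_const_mul' _ _ ENNReal.ofReal_ne_top]
    refine lintegral_congr fun ω => ?_
    rw [lintegral_exp_mul_sub_half_sq, mul_pow, Real.sq_sqrt h0]
    ring_nf
  rw [key, lintegral_lintegral_swap (by fun_prop)]
  have hin : ∀ x : ℝ, ∫⁻ ω, ENNReal.ofReal (Real.exp ((√u * X ω) * x - x ^ 2 / 2)) ∂μ
      ≤ ENNReal.ofReal (Real.exp (-((1 - u) / 2) * x ^ 2)) := by
    intro x
    have e : ∀ ω, ENNReal.ofReal (Real.exp ((√u * X ω) * x - x ^ 2 / 2))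
        = ENNReal.ofReal (Real.exp (-(x ^ 2 / 2))) * ENNReal.ofReal (Real.exp ((√u * x) * X ω)) := by
      intro ω
      rw [← ENNReal.ofReal_mul (Real.exp_pos _).le, ← Real.exp_add]
      ring_nf
    simp_rw [e]
    rw [lintegral_const_mul' _ _ ENNReal.ofReal_ne_top]
    refine (mul_le_mul_right (lintegral_exp_mul_le hX _) _).trans_eq ?_
    rw [← ENNReal.ofReal_mul (Real.exp_pos _).le, ← Real.exp_add, mul_pow, Real.sq_sqrt h0]
    congr 2
    push_cast
    ring
  refine (lintegral_mono hin).trans ?_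
  rw [lintegral_exp_neg_mul_sq (by linarith), ← ENNReal.ofReal_mul (Real.sqrt_nonneg _)]
  refine ENNReal.ofReal_le_ofReal (Real.sqrt_le_iff.2 ⟨by positivity, ?_⟩)
  rw [mul_pow, Real.sq_sqrt (by positivity), div_le_iff₀ (by linarith), ← Real.exp_nat_mul]
  have h1 := Real.quadratic_le_exp_of_nonneg (x := 2 * u) (by linarith)
  -- `(1 - u) exp (2u) ≥ (1 - u) (1 + 2u + 2u²) = 1 + u (1 - 2u²) ≥ 1` for `u ≤ 1/2`
  have h2 : 1 ≤ (1 - u) * Real.exp (2 * u) := by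
    refine le_trans ?_ (mul_le_mul_of_nonneg_left h1 (by linarith))
    nlinarith [mul_nonneg h0 (by nlinarith : 0 ≤ 1 - 2 * u ^ 2)]
  push_cast
  nlinarith

theorem exp_le_one_add_add_sq_mul_exp_abs (y : ℝ) :
    Real.exp y ≤ 1 + y + y ^ 2 * Real.exp |y| := by
  have h := Complex.norm_exp_sub_sum_le_norm_mul_exp (y : ℂ) 2
  have e : Complex.exp y - ∑ m ∈ Finset.range 2, (y : ℂ) ^ m / (m.factorial : ℂ)
      = ((Real.exp y - (1 + y) : ℝ) : ℂ) := by
    simp [Finset.sum_range_succ]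
  rw [e, Complex.norm_real, Complex.norm_real, Real.norm_eq_abs, Real.norm_eq_abs, sq_abs] at h
  linarith [le_abs_self (Real.exp y - (1 + y))]

/-- The centered square of a sub-Gaussian variable of variance one is sub-exponential. -/
theorem lintegral_exp_centered_sq_le [IsProbabilityMeasure μ] {X : Ω → ℝ} (hXm : Measurable X)
    (hX : HasSubgaussianMGF X 1 μ) (hvar : ∫ ω, X ω ^ 2 ∂μ = 1) {t : ℝ} (ht : |t| ≤ 1 / 8) :
    ∫⁻ ω, ENNReal.ofReal (Real.exp (t * (X ω ^ 2 - 1))) ∂μ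
      ≤ ENNReal.ofReal (Real.exp (512 * t ^ 2)) := by
  have hsq := lintegral_exp_sq_le hXm hX (u := 1 / 2) (by norm_num) le_rfl
  norm_num at hsq
  have hXi : Integrable (fun ω => X ω ^ 2) μ := by
    by_contra h
    rw [integral_undef h] at hvar
    norm_num at hvar
  have hEi : Integrable (fun ω => Real.exp (1 / 4 * X ω ^ 2)) μ := by
    refine ⟨by fun_prop, ?_⟩
    rw [hasFiniteIntegral_iff_ofReal (Filter.Eventually.of_forall fun _ => (Real.exp_pos _).le)]
    exact hsq.trans_lt ENNReal.ofReal_lt_top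
  have hE : ∫ ω, Real.exp (1 / 4 * X ω ^ 2) ∂μ ≤ Real.exp (1 / 2) := by
    rw [← ENNReal.ofReal_le_ofReal_iff (Real.exp_pos _).le,
      ofReal_integral_eq_lintegral_ofReal hEi
        (Filter.Eventually.of_forall fun _ => (Real.exp_pos _).le)]
    exact hsq
  -- the quadratic remainder is dominated by `exp (X² / 4)`, as `v² ≤ 128 exp (v / 8)`
  have hpt : ∀ ω, Real.exp (t * (X ω ^ 2 - 1))
      ≤ 1 + t * (X ω ^ 2 - 1) + t ^ 2 * (128 * Real.exp (1 / 4)) * Real.exp (1 / 4 * X ω ^ 2) := by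
    intro ω
    set v := |X ω ^ 2 - 1| with hv
    have hv0 : 0 ≤ v := abs_nonneg _
    have hvX : v ≤ X ω ^ 2 + 1 := by
      rw [hv, abs_le]; constructor <;> nlinarith [sq_nonneg (X ω)]
    have h1 := exp_le_one_add_add_sq_mul_exp_abs (t * (X ω ^ 2 - 1))
    have h2 : v ^ 2 ≤ 128 * Real.exp (v / 8) := by
      nlinarith [Real.quadratic_le_exp_of_nonneg (x := v / 8) (by positivity)]
    have h3 : Real.exp |t * (X ω ^ 2 - 1)| ≤ Real.exp (v / 8) := by
      rw [abs_mul]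
      exact Real.exp_le_exp.2 (by nlinarith)
    have h4 : Real.exp (v / 8) * Real.exp (v / 8)
        ≤ Real.exp (1 / 4) * Real.exp (1 / 4 * X ω ^ 2) := by
      rw [← Real.exp_add, ← Real.exp_add]
      exact Real.exp_le_exp.2 (by linarith)
    have h5 : (X ω ^ 2 - 1) ^ 2 * Real.exp |t * (X ω ^ 2 - 1)|
        ≤ 128 * (Real.exp (1 / 4) * Real.exp (1 / 4 * X ω ^ 2)) := by
      rw [← sq_abs (X ω ^ 2 - 1), ← hv]
      calc v ^ 2 * Real.exp |t * (X ω ^ 2 - 1)|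
          ≤ 128 * Real.exp (v / 8) * Real.exp (v / 8) := by gcongr
        _ ≤ _ := by rw [mul_assoc]; gcongr
    have h6 := mul_le_mul_of_nonneg_left h5 (sq_nonneg t)
    nlinarith
  have hLi : Integrable (fun ω => t * (X ω ^ 2 - 1)) μ :=
    (hXi.sub (integrable_const _)).const_mul _
  have hRi : Integrable (fun ω => t ^ 2 * (128 * Real.exp (1 / 4))
      * Real.exp (1 / 4 * X ω ^ 2)) μ := hEi.const_mul _
  have h1i : Integrable (fun ω => 1 + t * (X ω ^ 2 - 1)) μ := (integrable_const _).add hLi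
  have hgi : Integrable (fun ω => 1 + t * (X ω ^ 2 - 1)
      + t ^ 2 * (128 * Real.exp (1 / 4)) * Real.exp (1 / 4 * X ω ^ 2)) μ := h1i.add hRi
  refine (lintegral_mono fun ω => ENNReal.ofReal_le_ofReal (hpt ω)).trans ?_
  rw [← ofReal_integral_eq_lintegral_ofReal hgi
    (Filter.Eventually.of_forall fun ω => (Real.exp_pos _).le.trans (hpt ω))]
  refine ENNReal.ofReal_le_ofReal ?_
  rw [integral_add h1i hRi, integral_add (integrable_const _) hLi, integral_const_mul,
    integral_const_mul, integral_sub hXi (integrable_const _), hvar]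
  have hhalf : Real.exp (1 / 2) ≤ 2 := by
    have := Real.exp_bound_div_one_sub_of_interval (x := 1 / 2) (by norm_num) (by norm_num)
    norm_num at this ⊢
    exact this
  have hnum : Real.exp (1 / 4) * ∫ ω, Real.exp (1 / 4 * X ω ^ 2) ∂μ ≤ 2 * 2 :=
    mul_le_mul ((Real.exp_le_exp.2 (by norm_num)).trans hhalf) (hE.trans hhalf)
      (integral_nonneg fun _ => (Real.exp_pos _).le) (by norm_num)
  have hlast := Real.add_one_le_exp (512 * t ^ 2)
  simp only [integral_const, probReal_univ, smul_eq_mul, mul_one, sub_self, mul_zero, add_zero]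
  nlinarith [mul_le_mul_of_nonneg_left hnum (sq_nonneg t)]

/-- Chernoff's bound for sub-exponential sums, at the optimal exponent `t = τ / (2B)`. -/
theorem measure_abs_gt_le {Z : Ω → ℝ} (hZ : Measurable Z) {m B τ t : ℝ} (hB : 0 < B) (hτ : 0 < τ)
    (ht : t = τ / (2 * B))
    (h : ∀ s, s = t ∨ s = -t →
      ∫⁻ ω, ENNReal.ofReal (Real.exp (s * Z ω)) ∂μ ≤ ENNReal.ofReal (Real.exp (m * (B * t ^ 2)))) :
    μ {ω | m * τ < |Z ω|} ≤ ENNReal.ofReal (2 * Real.exp (-(m * τ ^ 2 / (4 * B)))) := by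
  have ht0 : 0 < t := by rw [ht]; positivity
  have hexp : m * (B * t ^ 2) - t * (m * τ) = -(m * τ ^ 2 / (4 * B)) := by
    rw [ht]; field_simp; ring
  have one : ∀ s, s = t ∨ s = -t → μ {ω | t * (m * τ) ≤ s * Z ω}
      ≤ ENNReal.ofReal (Real.exp (-(m * τ ^ 2 / (4 * B)))) := by
    intro s hs
    have hmk := mul_meas_ge_le_lintegral (μ := μ)
      (f := fun ω => ENNReal.ofReal (Real.exp (s * Z ω))) (by fun_prop)
      (ENNReal.ofReal (Real.exp (t * (m * τ))))
    have hset : {ω | ENNReal.ofReal (Real.exp (t * (m * τ))) ≤ ENNReal.ofReal (Real.exp (s * Z ω))}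
        = {ω | t * (m * τ) ≤ s * Z ω} := by
      ext ω
      simp only [Set.mem_ofPred_eq]
      rw [ENNReal.ofReal_le_ofReal_iff (Real.exp_pos _).le, Real.exp_le_exp]
    rw [hset] at hmk
    have h2 := hmk.trans (h s hs)
    rw [← hexp, Real.exp_sub, ENNReal.ofReal_div_of_pos (Real.exp_pos _)]
    rw [ENNReal.le_div_iff_mul_le (by simp [Real.exp_pos]) (by simp), mul_comm]
    exact h2
  have hsub : {ω | m * τ < |Z ω|}
      ⊆ {ω | t * (m * τ) ≤ t * Z ω} ∪ {ω | t * (m * τ) ≤ -t * Z ω} := by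
    intro ω hω
    rcases lt_abs.1 (show m * τ < |Z ω| from hω) with h | h
    · exact Or.inl (mul_le_mul_of_nonneg_left h.le ht0.le)
    · right
      show t * (m * τ) ≤ -t * Z ω
      nlinarith
  refine (measure_mono hsub).trans ((measure_union_le _ _).trans
    ((add_le_add (one t (Or.inl rfl)) (one (-t) (Or.inr rfl))).trans_eq ?_))
  rw [← ENNReal.ofReal_add (Real.exp_pos _).le (Real.exp_pos _).le, two_mul]

end ExponentialMoments

/-! ### Concentration in the random model -/

section Model

variable {Ω : Type*} [MeasurableSpace Ω] {μ : Measure Ω} {n d : ℕ}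
  {M : Ω → Matrix (Fin n) (Fin d) ℝ} {z : Fin d → ℝ} {ε : Ω → Fin n → ℝ} {σ : ℕ} {ϱ : ℝ≥0}

theorem FeatureModel.hasSubgaussianMGF_M (h : FeatureModel μ σ ϱ M z ε) (k : Fin n) (i : Fin d) :
    HasSubgaussianMGF (fun ω => M ω k i) 1 μ := by
  have := h.subG_M k i
  simpa only [IsSG, h.centered_M k i, sub_zero] using this

theorem FeatureModel.hasSubgaussianMGF_ε (h : FeatureModel μ σ ϱ M z ε) (k : Fin n) :
    HasSubgaussianMGF (fun ω => ε ω k) (ϱ ^ 2) μ := by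
  have := h.subG_ε k
  simpa only [IsSG, h.centered_ε k, sub_zero] using this

theorem FeatureModel.integral_sq_M (h : FeatureModel μ σ ϱ M z ε) (k : Fin n) (i : Fin d) :
    ∫ ω, M ω k i ^ 2 ∂μ = 1 := by
  rw [← h.variance_M k i, variance_eq_integral (h.measurable_M k i).aemeasurable,
    h.centered_M k i]
  simp

end Model

section Concentration

variable {Ω : Type*} [MeasurableSpace Ω] {μ : Measure Ω} [IsProbabilityMeasure μ] {n d : ℕ}

/-- Exponential moment of the correlation of the `i`-th column of `M` with `M v + ε`, where `v`
does not charge that column: integrating out `ε`, then the other columns, leaves the exponential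
moment of the squared norm of the `i`-th column. -/
theorem lintegral_exp_column_correlation_le {M : Ω → Matrix (Fin n) (Fin d) ℝ}
    {ε : Ω → Fin n → ℝ} (hM : ∀ k i, Measurable fun ω => M ω k i)
    (hind : iIndepFun (fun (p : Fin n × Fin d) ω => M ω p.1 p.2) μ)
    (hsub : ∀ k i, HasSubgaussianMGF (fun ω => M ω k i) 1 μ) (hε : ∀ k, Measurable fun ω => ε ω k)
    (hMε : IndepFun (fun ω (p : Fin n × Fin d) => M ω p.1 p.2) ε μ) {r : ℝ≥0}
    (hlin : ∀ a : Fin n → ℝ, ∫⁻ ω, ENNReal.ofReal (Real.exp (∑ k, a k * ε ω k)) ∂μ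
      ≤ ENNReal.ofReal (Real.exp (r * (∑ k, a k ^ 2) / 2)))
    (i : Fin d) {v : Fin d → ℝ} (hv : v i = 0) {t B : ℝ} (hB : ∑ j, v j ^ 2 + r ≤ B)
    (ht : B * t ^ 2 ≤ 1 / 2) :
    ∫⁻ ω, ENNReal.ofReal (Real.exp (t * ∑ k, M ω k i * ((M ω *ᵥ v) k + ε ω k))) ∂μ
      ≤ ENNReal.ofReal (Real.exp (n * (B * t ^ 2))) := by
  have hB0 : 0 ≤ B := le_trans (by positivity) hB
  have hcol : ∀ k, Measurable fun ω => M ω k i := fun k => hM k i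
  have hnoise : ∫⁻ ω, ENNReal.ofReal (Real.exp (t * ∑ k, M ω k i * ((M ω *ᵥ v) k + ε ω k))) ∂μ
      ≤ ∫⁻ ω, ENNReal.ofReal (Real.exp (t * ∑ k, M ω k i * (M ω *ᵥ v) k
          + r * (∑ k, (t * M ω k i) ^ 2) / 2)) ∂μ := by
    refine lintegral_comp_le_of_indepFun hMε (measurable_pi_lambda _ fun p => hM p.1 p.2)
      (measurable_pi_lambda _ hε)
      (f := fun q : (Fin n × Fin d → ℝ) × (Fin n → ℝ) => ENNReal.ofReal (Real.exp
        (t * ∑ k, q.1 (k, i) * ((∑ j, q.1 (k, j) * v j) + q.2 k)))) (by fun_prop)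
      (g := fun m => ENNReal.ofReal (Real.exp (t * ∑ k, m (k, i) * (∑ j, m (k, j) * v j)
        + r * (∑ k, (t * m (k, i)) ^ 2) / 2))) (by fun_prop) fun m => ?_
    have e : ∀ ω, ENNReal.ofReal (Real.exp
        (t * ∑ k, m (k, i) * ((∑ j, m (k, j) * v j) + ε ω k)))
        = ENNReal.ofReal (Real.exp (t * ∑ k, m (k, i) * (∑ j, m (k, j) * v j)))
          * ENNReal.ofReal (Real.exp (∑ k, (t * m (k, i)) * ε ω k)) := fun ω => by
      rw [← ENNReal.ofReal_mul (Real.exp_pos _).le, ← Real.exp_add]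
      simp only [mul_add, Finset.sum_add_distrib, Finset.mul_sum, mul_assoc]
    simp only [e]
    rw [lintegral_const_mul' _ _ ENNReal.ofReal_ne_top, Real.exp_add,
      ENNReal.ofReal_mul (Real.exp_pos _).le]
    exact mul_le_mul_right (hlin _) _
  let S : Finset (Fin n × Fin d) := Finset.univ.filter fun p => p.2 = i
  let T : Finset (Fin n × Fin d) := Finset.univ.filter fun p => p.2 ≠ i
  have hST : IndepFun (fun ω (k : Fin n) => M ω k i)
      (fun ω (p : T) => M ω p.1.1 p.1.2) μ := by
    have h := hind.indepFun_finset S T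
      (Finset.disjoint_filter_filter_not _ _ _) fun p => hM p.1 p.2
    exact h.comp (φ := fun (f : S → ℝ) (k : Fin n) => f ⟨(k, i), by simp [S]⟩)
      (ψ := fun f => f) (measurable_pi_lambda _ fun k => measurable_pi_apply _) measurable_id
  have hsumT : ∀ F : Fin n × Fin d → ℝ, (∀ k, F (k, i) = 0) →
      ∑ p : T, F p = ∑ k, ∑ j, F (k, j) := fun F hF => by
    rw [Finset.sum_coe_sort T F, ← Fintype.sum_prod_type]
    refine Finset.sum_subset (Finset.subset_univ _) fun p _ hp => ?_
    have hp : p.2 = i := by simpa [T] using hp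
    rw [← hF p.1, ← hp]
  have hcolumns : ∫⁻ ω, ENNReal.ofReal (Real.exp (t * ∑ k, M ω k i * (M ω *ᵥ v) k
          + r * (∑ k, (t * M ω k i) ^ 2) / 2)) ∂μ
      ≤ ∫⁻ ω, ENNReal.ofReal (Real.exp (∑ k, B * t ^ 2 / 2 * M ω k i ^ 2)) ∂μ := by
    have e : ∀ ω, t * ∑ k, M ω k i * (M ω *ᵥ v) k
        = ∑ p : T, (t * M ω p.1.1 i * v p.1.2) * M ω p.1.1 p.1.2 := fun ω => by
      rw [hsumT (fun p => (t * M ω p.1 i * v p.2) * M ω p.1 p.2) (by simp [hv]), Finset.mul_sum]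
      refine Finset.sum_congr rfl fun k _ => ?_
      simp only [Matrix.mulVec, dotProduct, Finset.mul_sum]
      exact Finset.sum_congr rfl fun j _ => by ring
    simp only [e]
    refine lintegral_comp_le_of_indepFun hST (measurable_pi_lambda _ hcol)
      (measurable_pi_lambda _ fun p => hM _ _)
      (f := fun q : (Fin n → ℝ) × (T → ℝ) => ENNReal.ofReal (Real.exp
        (∑ p : T, (t * q.1 p.1.1 * v p.1.2) * q.2 p + r * (∑ k, (t * q.1 k) ^ 2) / 2)))
      (by fun_prop)
      (g := fun x => ENNReal.ofReal (Real.exp (∑ k, B * t ^ 2 / 2 * x k ^ 2))) (by fun_prop)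
      fun x => ?_
    simp only [Real.exp_add, ENNReal.ofReal_mul (Real.exp_pos _).le]
    rw [lintegral_mul_const' _ _ ENNReal.ofReal_ne_top]
    have h := lintegral_exp_linear_le (hind.precomp (g := fun p : T => p.1) Subtype.val_injective)
      (fun p => hM _ _) (c := 1) (fun p => hsub _ _) (fun p => t * x p.1.1 * v p.1.2)
    refine (mul_le_mul_left h _).trans ?_
    rw [← ENNReal.ofReal_mul (Real.exp_pos _).le, ← Real.exp_add]
    refine ENNReal.ofReal_le_ofReal (Real.exp_le_exp.2 ?_)
    rw [hsumT (fun p => (t * x p.1 * v p.2) ^ 2) (by simp [hv])]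
    have e1 : ∑ k, ∑ j, (t * x k * v j) ^ 2 = t ^ 2 * (∑ k, x k ^ 2) * ∑ j, v j ^ 2 := by
      simp only [mul_pow, ← Finset.mul_sum, ← Finset.sum_mul]
    rw [e1]
    simp only [mul_pow, ← Finset.mul_sum]
    have h0 : 0 ≤ t ^ 2 * ∑ k, x k ^ 2 := by positivity
    have := mul_le_mul_of_nonneg_left hB h0
    push_cast
    linarith
  refine hnoise.trans (hcolumns.trans ?_)
  have h := lintegral_exp_sum_le (hind.precomp (g := fun k : Fin n => (k, i))
      (fun a b h => (Prod.mk.inj h).1)) hcol (f := fun _ x => B * t ^ 2 / 2 * x ^ 2)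
    (fun _ => by fun_prop) (c := fun _ => B * t ^ 2)
    (fun k => lintegral_exp_sq_le (hcol k) (hsub k i) (by positivity) ht)
  simpa using h

variable {M : Ω → Matrix (Fin n) (Fin d) ℝ} {z : Fin d → ℝ} {ε : Ω → Fin n → ℝ} {σ : ℕ} {ϱ : ℝ≥0}

/-- The factor `2` between `τ²` and `B` keeps the exponent `τ / (2 B)` of Chernoff's bound in the
range where the exponential moment is controlled. -/
theorem FeatureModel.measure_column_correlation (h : FeatureModel μ σ ϱ M z ε) {i : Fin d}
    {v : Fin d → ℝ} (hv : v i = 0) {B τ : ℝ} (hB0 : 0 < B) (hB : ∑ j, v j ^ 2 + (ϱ : ℝ) ^ 2 ≤ B)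
    (hτ : 0 < τ) (hτB : τ ^ 2 ≤ 2 * B) :
    μ {ω | n * τ < |∑ k, M ω k i * ((M ω *ᵥ v) k + ε ω k)|}
      ≤ ENNReal.ofReal (2 * Real.exp (-(n * τ ^ 2 / (4 * B)))) := by
  have hM := h.measurable_M
  have hε := h.measurable_ε
  refine measure_abs_gt_le ?_ hB0 hτ rfl fun s hs => ?_
  · simp only [Matrix.mulVec, dotProduct]
    fun_prop
  · have hs2 : s ^ 2 = (τ / (2 * B)) ^ 2 := by rcases hs with rfl | rfl <;> ring
    rw [← hs2]
    refine lintegral_exp_column_correlation_le hM h.indep_M h.hasSubgaussianMGF_M hε h.indep_M_ε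
      (r := ϱ ^ 2) (fun a => ?_) i hv (by simpa using hB) ?_
    · exact lintegral_exp_linear_le h.indep_ε hε h.hasSubgaussianMGF_ε a
    · rw [hs2, div_pow, mul_div_assoc', div_le_iff₀ (by positivity)]
      nlinarith

/-- An off-diagonal Gram entry is a column correlation with `v` a coordinate vector and no noise. -/
theorem FeatureModel.measure_gram_offdiag (h : FeatureModel μ σ ϱ M z ε) {i j : Fin d}
    (hij : i ≠ j) {τ : ℝ} (hτ : 0 < τ) (hτ1 : τ ≤ 1) :
    μ {ω | n * τ < |((M ω)ᵀ * M ω) i j|}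
      ≤ ENNReal.ofReal (2 * Real.exp (-(n * τ ^ 2 / 4))) := by
  have hM := h.measurable_M
  have e : ∀ ω, ((M ω)ᵀ * M ω) i j = ∑ k, M ω k i * ((M ω *ᵥ Pi.single j 1) k + 0) := fun ω => by
    simp [Matrix.mul_apply]
  simp only [e]
  rw [show n * τ ^ 2 / 4 = n * τ ^ 2 / (4 * 1) by ring]
  refine measure_abs_gt_le ?_ one_pos hτ rfl fun s hs => ?_
  · simp only [Matrix.mulVec, dotProduct]
    fun_prop
  · have hs2 : s ^ 2 = (τ / (2 * 1)) ^ 2 := by rcases hs with rfl | rfl <;> ring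
    rw [← hs2]
    refine lintegral_exp_column_correlation_le hM h.indep_M h.hasSubgaussianMGF_M
      (ε := fun _ _ => 0) (fun _ => measurable_const) (indepFun_const_right _ _)
      (r := 0) (fun a => by simp) i (by simp [hij]) ?_ ?_
    · simp [Pi.single_apply]
    · rw [hs2]; nlinarith

theorem FeatureModel.measure_gram_diag (h : FeatureModel μ σ ϱ M z ε) (i : Fin d)
    {τ : ℝ} (hτ : 0 < τ) (hτ1 : τ ≤ 1) :
    μ {ω | n * τ < |((M ω)ᵀ * M ω) i i - n|}
      ≤ ENNReal.ofReal (2 * Real.exp (-(n * τ ^ 2 / (4 * 512)))) := by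
  have hM := h.measurable_M
  have e : ∀ ω, ((M ω)ᵀ * M ω) i i - n = ∑ k, (M ω k i ^ 2 - 1) := fun ω => by
    simp [Matrix.mul_apply, sq]
  simp only [e]
  refine measure_abs_gt_le (by fun_prop) (by norm_num) hτ rfl fun s hs => ?_
  have hs2 : s ^ 2 = (τ / (2 * 512)) ^ 2 := by rcases hs with rfl | rfl <;> ring
  have hs8 : |s| ≤ 1 / 8 := abs_le_of_sq_le_sq (by rw [hs2]; nlinarith) (by norm_num)
  rw [← hs2]
  have h1 := lintegral_exp_sum_le (h.indep_M.precomp (g := fun k : Fin n => (k, i))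
      (fun a b h => (Prod.mk.inj h).1)) (fun k => hM k i) (f := fun _ x => s * (x ^ 2 - 1))
    (fun _ => by fun_prop) (c := fun _ => 512 * s ^ 2)
    (fun k => lintegral_exp_centered_sq_le (hM k i) (h.hasSubgaussianMGF_M k i)
      (h.integral_sq_M k i) hs8)
  simp only [Finset.sum_const, Finset.card_univ, Fintype.card_fin, nsmul_eq_mul] at h1
  simpa only [Finset.mul_sum] using h1

end Concentration

/-! ### Recovery with high probability -/

theorem theorem5p4 :
    ∃ C K : ℝ, 0 < C ∧ 0 < K ∧
      ∀ (n d σ : ℕ) (ϱ : ℝ≥0), 1 ≤ σ → σ ≤ d →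
      (n : ℝ) ≥ C * ((σ : ℝ) ^ 2 + (d : ℝ) + (ϱ : ℝ) ^ 2) * Real.log (d : ℝ) →
      ∀ (Ω : Type*) [MeasurableSpace Ω] (μ : Measure Ω) [IsProbabilityMeasure μ]
        (M : Ω → Matrix (Fin n) (Fin d) ℝ) (z : Fin d → ℝ) (ε : Ω → Fin n → ℝ),
        FeatureModel μ σ ϱ M z ε →
        μ {ω | ¬ SDPSolvesSILS (M ω) (M ω *ᵥ z + ε ω) σ} ≤
          ENNReal.ofReal (K / (d : ℝ) + K * Real.exp (-(σ : ℝ))) := by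
  -- the largest requirement on `n` comes from the diagonal Gram entries, whose failure probability
  -- is at most `2 / d³` once `n ≥ 3 · 4 · 512 · 16² σ² log d = 1572864 σ² log d`
  refine ⟨2000000, 4, by norm_num, by norm_num, ?_⟩
  intro n d σ ϱ hσ hσd hn Ω _ μ _ M z ε h
  have hσ' : (1 : ℝ) ≤ σ := by exact_mod_cast hσ
  have hd1 : (1 : ℝ) ≤ d := by exact_mod_cast hσ.trans hσd
  have hd0 : (0 : ℝ) < d := by linarith
  rcases Nat.eq_zero_or_pos n with hn0 | hn0
  · -- then `log d = 0`, so `d = 1` and the bound exceeds `1`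
    have hlog : Real.log d ≤ 0 := by
      by_contra! hlog
      have : 0 < 2000000 * ((σ : ℝ) ^ 2 + d + (ϱ : ℝ) ^ 2) * Real.log d := by positivity
      rw [hn0] at hn
      norm_num at hn
      linarith
    have hd : (d : ℝ) = 1 := by
      by_contra hne
      exact absurd (Real.log_pos (lt_of_le_of_ne hd1 (Ne.symm hne))) (not_lt.2 hlog)
    refine prob_le_one.trans ?_
    rw [← ENNReal.ofReal_one, hd]
    refine ENNReal.ofReal_le_ofReal ?_
    have := Real.exp_pos (-(σ : ℝ))
    linarith
  have hn' : (0 : ℝ) < n := by exact_mod_cast hn0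
  have hlog := Real.log_nonneg hd1
  have tail : ∀ a b : ℝ, 0 < b → 3 * b ≤ 2000000 * ((σ : ℝ) ^ 2 + d + (ϱ : ℝ) ^ 2) * a → 0 < a →
      ENNReal.ofReal (2 * Real.exp (-(n * a / b))) ≤ ENNReal.ofReal (2 / (d : ℝ) ^ 3) := by
    intro a b hb hab ha
    refine ENNReal.ofReal_le_ofReal ?_
    have h1 : 3 * Real.log d ≤ n * a / b := by
      rw [le_div_iff₀ hb]
      have := mul_le_mul_of_nonneg_right hab hlog
      have := mul_le_mul_of_nonneg_right hn ha.le
      linarith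
    have h2 : Real.exp (-(n * a / b)) ≤ ((d : ℝ) ^ 3)⁻¹ := by
      refine (Real.exp_le_exp.2 (neg_le_neg h1)).trans_eq ?_
      rw [Real.exp_neg, show 3 * Real.log d = ((3 : ℕ) : ℝ) * Real.log d by norm_num,
        Real.exp_nat_mul, Real.exp_log hd0]
    rw [div_eq_mul_inv 2]
    linarith
  have hτ0 : (0 : ℝ) < 1 / (16 * σ) := by positivity
  have hτ1 : (1 : ℝ) / (16 * σ) ≤ 1 := by rw [div_le_one (by positivity)]; linarith
  have hpos : 0 ≤ (d : ℝ) + (ϱ : ℝ) ^ 2 := by positivity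
  have hτσ : ((σ : ℝ) ^ 2 + d + (ϱ : ℝ) ^ 2) * (1 / (16 * σ)) ^ 2 ≥ 1 / 256 := by
    rw [ge_iff_le, div_pow, mul_div_assoc', div_le_div_iff₀ (by norm_num) (by positivity)]
    nlinarith
  let Z : Fin d → Fin d → Set Ω := fun i j =>
    {ω | n * (1 / (16 * (σ : ℝ)))
      < |((M ω)ᵀ * M ω) i j - n * (1 : Matrix (Fin d) (Fin d) ℝ) i j|}
  have hZ : ∀ i j, μ (Z i j) ≤ ENNReal.ofReal (2 / (d : ℝ) ^ 3) := by
    intro i j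
    by_cases hij : i = j
    · subst hij
      simp only [Z, Matrix.one_apply_eq, mul_one]
      exact (h.measure_gram_diag i hτ0 hτ1).trans
        (tail _ _ (by norm_num) (by linarith) (by positivity))
    · simp only [Z, Matrix.one_apply_ne hij, mul_zero, sub_zero]
      exact (h.measure_gram_offdiag hij hτ0 hτ1).trans
        (tail _ _ (by norm_num) (by linarith) (by positivity))
  have hz4 : ∀ i, z i ^ 2 ≤ 4 := fun i => by
    rcases lt_or_ge (i : ℕ) σ with hi | hi
    · rcases h.z_head i hi with h | h <;> norm_num [h]
    · rcases h.z_tail i hi with h | h <;> norm_num [h]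
  let v : Fin d → Fin d → ℝ := fun i => Function.update z i 0
  let Y : Fin d → Set Ω := fun i =>
    {ω | n * (1 / 8 : ℝ) < |∑ k, M ω k i * ((M ω *ᵥ v i) k + ε ω k)|}
  have hY : ∀ i, μ (Y i) ≤ ENNReal.ofReal (2 / (d : ℝ) ^ 3) := by
    intro i
    have hv : ∑ j, v i j ^ 2 ≤ 4 * d := by
      have : ∀ j, v i j ^ 2 ≤ 4 := fun j => by
        by_cases hj : j = i
        · simp [v, hj]
        · simpa [v, Function.update_of_ne hj] using hz4 j
      refine (Finset.sum_le_sum fun j _ => this j).trans ?_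
      simp [mul_comm]
    refine (h.measure_column_correlation (i := i) (v := v i) (B := 4 * d + (ϱ : ℝ) ^ 2)
      (by simp [v]) (by positivity) (by linarith) (by norm_num) (by norm_num; nlinarith)).trans
      (tail _ _ (by positivity) ?_ (by norm_num))
    nlinarith [sq_nonneg (ϱ : ℝ), sq_nonneg (σ : ℝ)]
  have hsub : {ω | ¬ SDPSolvesSILS (M ω) (M ω *ᵥ z + ε ω) σ} ⊆ (⋃ i, ⋃ j, Z i j) ∪ ⋃ i, Y i := by
    intro ω hω
    by_contra hbad
    simp only [Set.mem_union, Set.mem_iUnion, not_or, not_exists, Z, Y, Set.mem_ofPred_eq,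
      not_lt] at hbad
    obtain ⟨hG, hc⟩ := hbad
    refine hω ?_
    have hx : ∀ i : Fin d, (if (i : ℕ) < σ then z i / 2 else 0) = 0 ∧ |z i| ≤ 1 ∨
        (if (i : ℕ) < σ then z i / 2 else 0) = 1 ∧ z i = 2 ∨
        (if (i : ℕ) < σ then z i / 2 else 0) = -1 ∧ z i = -2 := by
      intro i
      by_cases hi : (i : ℕ) < σ
      · rcases h.z_head i hi with h | h <;> simp [hi, h]
      · rcases h.z_tail i (not_lt.1 hi) with h | h <;> simp [hi, h]
    refine SDPSolvesSILS.of_entrywise_close hn0 hσ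
      (x := fun i => if (i : ℕ) < σ then z i / 2 else 0) (z := z) ⟨fun i => ?_, ?_⟩ hx hG
      fun i => ?_
    · rcases hx i with h | h | h
      · exact Or.inl h.1
      · exact Or.inr (Or.inl h.1)
      · exact Or.inr (Or.inr h.1)
    · have : (Finset.univ.filter fun i : Fin d => (if (i : ℕ) < σ then z i / 2 else 0) ≠ 0)
          = Finset.univ.filter fun i : Fin d => (i : ℕ) < σ := by
        refine Finset.filter_congr fun i _ => ?_
        by_cases hi : (i : ℕ) < σ
        · rcases h.z_head i hi with h | h <;> simp [hi, h]
        · simp [hi]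
      rw [this, Fin.card_filter_val_lt, min_eq_right hσd]
    · -- splitting off the `i`-th column of `M z` leaves the diagonal entry of the Gram matrix
      have hz : z = v i + z i • Pi.single i 1 := by
        ext j
        by_cases hj : j = i
        · subst hj; simp [v]
        · simp [v, hj]
      have e : ((M ω)ᵀ *ᵥ (M ω *ᵥ z + ε ω)) i - n * z i
          = ∑ k, M ω k i * ((M ω *ᵥ v i) k + ε ω k) + (((M ω)ᵀ * M ω) i i - n) * z i := by
        have e1 : M ω *ᵥ z = M ω *ᵥ v i + z i • (M ω *ᵥ Pi.single i 1) := by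
          conv_lhs => rw [hz]
          rw [Matrix.mulVec_add, Matrix.mulVec_smul]
        rw [e1]
        simp only [Matrix.mulVec_single_one, Matrix.mulVec, dotProduct, Matrix.transpose_apply,
          Matrix.mul_apply, Pi.add_apply, Pi.smul_apply, smul_eq_mul, sub_mul, Finset.sum_mul,
          mul_add, Finset.sum_add_distrib, Matrix.col_apply]
        have : ∀ k, M ω k i * (z i * M ω k i) = M ω k i * M ω k i * z i := fun k => by ring
        simp only [this]
        ring
      have hGi := hG i i
      rw [Matrix.one_apply_eq, mul_one] at hGi
      have hzi : |z i| ≤ 2 := abs_le_of_sq_le_sq (by linarith [hz4 i]) (by norm_num)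
      have hGn : (n : ℝ) * (1 / (16 * σ)) ≤ n / 16 := by
        rw [mul_one_div]
        exact div_le_div_of_nonneg_left hn'.le (by norm_num) (by linarith)
      rw [e]
      refine (abs_add_le _ _).trans ?_
      rw [abs_mul]
      have := mul_le_mul (hGi.trans hGn) hzi (abs_nonneg _) (by positivity)
      linarith [hc i]
  have hunion : μ ((⋃ i, ⋃ j, Z i j) ∪ ⋃ i, Y i)
      ≤ ENNReal.ofReal (d * (d * (2 / (d : ℝ) ^ 3)) + d * (2 / (d : ℝ) ^ 3)) := by
    rw [ENNReal.ofReal_add (by positivity) (by positivity), ENNReal.ofReal_mul hd0.le,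
      ENNReal.ofReal_mul hd0.le, ENNReal.ofReal_natCast]
    refine (measure_union_le _ _).trans (add_le_add ?_ ?_)
    · refine (measure_iUnion_fintype_le _ _).trans
        ((Finset.sum_le_sum fun i _ => (measure_iUnion_fintype_le _ _).trans
          (Finset.sum_le_sum fun j _ => hZ i j)).trans ?_)
      simp
    · exact (measure_iUnion_fintype_le _ _).trans
        ((Finset.sum_le_sum fun i _ => hY i).trans (by simp))
  refine (measure_mono hsub).trans (hunion.trans (ENNReal.ofReal_le_ofReal ?_))
  have h1 : d * (d * (2 / (d : ℝ) ^ 3)) = 2 / d := by field_simp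
  have h2 : d * (2 / (d : ℝ) ^ 3) ≤ 2 / d := by
    rw [← h1]
    exact mul_le_mul_of_nonneg_left (le_mul_of_one_le_left (by positivity) hd1) hd0.le
  have h3 : (4 : ℝ) / d = 2 / d + 2 / d := by ring
  have := Real.exp_pos (-(σ : ℝ))
  rw [h1, h3]
  linarith
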